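/- All rings are commutative with $1$, and multiplicatively closed sets contain $1$. Let $R\subset S$ be a ring extension and let $[R,S]$ denote the set of $R$-subalgebras of $S$. The extension $R\subset S$ is called a QR-extension if every $T\in[R,S]$ is isomorphic, as an $R$-algebra, to a localization $R_\Sigma$ of $R$ at some multiplicatively closed subset $\Sigma$ of $R$. An extension $R\subseteq S'$ is called Prüfer if $R\subseteq T$ is a flat epimorphism of rings for every $R$-subalgebra $T$ of $S'$. An element $s\in R$ is called a locally strong divisor of $R$ if $s$ is regular (not a zero-divisor) and $R\subseteq R_s$ is Prüfer. Below, $T=R_s$ and $T=R_{\mathcal T}$ mean that $T$ is isomorphic, as an $R$-algebra, to the localization of $R$ at $\{s^n : n\geq 0\}$, respectively at $\mathcal T$. **Theorem.** Let $R\subset S$ be a ring extension. Then $R\subset S$ is a QR-extension if and only if for every $T\in[R,S]$ of finite type over $R$ there is a locally strong divisor $s$ of $R$ with $T=R_s$. Moreover, if these equivalent conditions hold, then for every $T\in[R,S]$ there is a multiplicatively closed subset $\mathcal T$ of $R$, all of whose elements are locally strong divisors of $R$, such that $T=R_{\mathcal T}$. -/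

import Mathlib

/-- An extension `R ⊆ S` of commutative rings (an `R`-algebra `S` with injective structure map) is
Prüfer if `R ⊆ T` is a flat epimorphism for every `R`-subalgebra `T` of `S`. -/
def IsPruferExtension (R S : Type*) [CommRing R] [CommRing S] [Algebra R S] : Prop :=
  Function.Injective (algebraMap R S) ∧
    ∀ T : Subalgebra R S, Module.Flat R T ∧ Algebra.IsEpi R T

/-- An extension `R ⊆ S` of commutative rings is a QR-extension if every `R`-subalgebra of `S` is
isomorphic, as an `R`-algebra, to a localization of `R` at a multiplicatively closed set. -/
def IsQRExtension (R S : Type*) [CommRing R] [CommRing S] [Algebra R S] : Prop :=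
  Function.Injective (algebraMap R S) ∧
    ∀ T : Subalgebra R S, ∃ M : Submonoid R, IsLocalization M T

/-- An element `s` of a commutative ring `R` is a locally strong divisor if it is regular and the
extension `R ⊆ R_s` is Prüfer. -/
def IsLocallyStrongDivisor {R : Type*} [CommRing R] (s : R) : Prop :=
  IsRegular s ∧ IsPruferExtension R (Localization.Away s)

/-! If `s` in `R` becomes a unit in `S`, then `R_s` embeds in `S` and inherits the QR property;
localizations are flat epimorphisms, so `s` is locally strong. This covers every denominator of
every intermediate localization. Finite type reduces the denominators to one; conversely, each `T`
is the union of its subalgebras `R[t]`. -/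

/-- An injective algebra in which the members of `M` are invertible and every element is a
fraction with denominator in `M` is the localization at `M`. -/
theorem isLocalization_of_injective {R A : Type*} [CommRing R] [CommRing A] [Algebra R A]
    (hinj : Function.Injective (algebraMap R A)) (M : Submonoid R)
    (hunit : ∀ m ∈ M, IsUnit (algebraMap R A m))
    (hfrac : ∀ t : A, ∃ m ∈ M, ∃ a : R, t * algebraMap R A m = algebraMap R A a) :
    IsLocalization M A where
  map_units m := hunit m m.2
  surj t := by
    obtain ⟨m, hm, a, h⟩ := hfrac t
    exact ⟨(a, ⟨m, hm⟩), h⟩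
  exists_of_eq h := ⟨1, by rw [hinj h]⟩

/-- An injective localization of finite type is a localization away from one element. -/
theorem exists_isLocalization_away_of_finiteType {R A : Type*} [CommRing R] [CommRing A]
    [Algebra R A] (hinj : Function.Injective (algebraMap R A)) (M : Submonoid R)
    [IsLocalization M A] (hA : Algebra.FiniteType R A) :
    ∃ s ∈ M, IsLocalization.Away s A := by
  obtain ⟨G, hG⟩ := hA.out
  obtain ⟨b, hb⟩ := IsLocalization.exist_integer_multiples_of_finset M G
  -- The common denominator `b` of the generators suffices: a polynomial in them is cleared by a
  -- power of `b`.
  refine ⟨b, b.2, isLocalization_of_injective hinj _ ?_ fun t => ?_⟩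
  · rintro _ ⟨n, rfl⟩
    rw [map_pow]
    exact (IsLocalization.map_units A b).pow n
  · have ht : t ∈ Algebra.adjoin R (G : Set A) := hG ▸ Algebra.mem_top
    suffices h : ∃ n : ℕ, ∃ a : R, t * algebraMap R A ((b : R) ^ n) = algebraMap R A a by
      obtain ⟨n, h⟩ := h
      exact ⟨(b : R) ^ n, ⟨n, rfl⟩, h⟩
    induction ht using Algebra.adjoin_induction with
    | mem x hx =>
      obtain ⟨a, ha⟩ := hb x hx
      exact ⟨1, a, by rw [pow_one, mul_comm, ← Algebra.smul_def, ha]⟩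
    | algebraMap r => exact ⟨0, r, by simp⟩
    | add x y _ _ hx hy =>
      obtain ⟨n, a, ha⟩ := hx
      obtain ⟨m, c, hc⟩ := hy
      refine ⟨n + m, a * (b : R) ^ m + c * (b : R) ^ n, ?_⟩
      simp only [map_add, map_mul, pow_add, ← ha, ← hc]
      ring
    | mul x y _ _ hx hy =>
      obtain ⟨n, a, ha⟩ := hx
      obtain ⟨m, c, hc⟩ := hy
      refine ⟨n + m, a * c, ?_⟩
      simp only [map_mul, pow_add, ← ha, ← hc]
      ring

/-- QR-extensions restrict along injective algebra maps. -/
theorem IsQRExtension.of_injective {R A S : Type*} [CommRing R] [CommRing A] [CommRing S]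
    [Algebra R A] [Algebra R S] (h : IsQRExtension R S) (f : A →ₐ[R] S)
    (hf : Function.Injective f) : IsQRExtension R A := by
  refine ⟨fun x y hxy => h.1 ?_, fun U => ?_⟩
  · rw [← f.commutes, ← f.commutes, hxy]
  · obtain ⟨M, hM⟩ := h.2 (U.map f)
    exact ⟨M, IsLocalization.isLocalization_of_algEquiv M (U.equivMapOfInjective f hf).symm⟩

open scoped TensorProduct in
-- `1 ⊗ t` and `t ⊗ 1` agree once multiplied by a denominator of `t`, which is a unit in `A ⊗ A`.
theorem IsLocalization.isEpi {R : Type*} [CommRing R] (M : Submonoid R) (A : Type*) [CommRing A]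
    [Algebra R A] [IsLocalization M A] : Algebra.IsEpi R A := by
  refine (Algebra.isEpi_iff_forall_one_tmul_eq R A).mpr fun t => ?_
  obtain ⟨⟨a, m⟩, ha⟩ := IsLocalization.surj M t
  have hm : IsUnit (algebraMap R (A ⊗[R] A) m) :=
    (IsLocalization.map_units A m).map (algebraMap A (A ⊗[R] A))
  refine hm.mul_right_cancel ?_
  have h : t * algebraMap R A m = algebraMap R A a := ha
  calc (1 ⊗ₜ[R] t) * algebraMap R (A ⊗[R] A) m = 1 ⊗ₜ algebraMap R A a := by
        rw [Algebra.TensorProduct.algebraMap_apply', Algebra.TensorProduct.tmul_mul_tmul, one_mul, h]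
    _ = algebraMap R A a ⊗ₜ 1 := by
        rw [← Algebra.TensorProduct.algebraMap_apply', Algebra.TensorProduct.algebraMap_apply]
    _ = (t ⊗ₜ[R] 1) * algebraMap R (A ⊗[R] A) m := by
        rw [Algebra.TensorProduct.algebraMap_apply, Algebra.TensorProduct.tmul_mul_tmul, one_mul, h]

theorem IsQRExtension.isPruferExtension {R S : Type*} [CommRing R] [CommRing S] [Algebra R S]
    (h : IsQRExtension R S) : IsPruferExtension R S := by
  refine ⟨h.1, fun T => ?_⟩
  obtain ⟨M, hM⟩ := h.2 T
  exact ⟨IsLocalization.flat T M, IsLocalization.isEpi M T⟩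

/-- In a QR-extension, every element of the base that becomes invertible is a locally strong
divisor. -/
theorem IsQRExtension.isLocallyStrongDivisor {R S : Type*} [CommRing R] [CommRing S]
    [Algebra R S] (h : IsQRExtension R S) {s : R} (hs : IsUnit (algebraMap R S s)) :
    IsLocallyStrongDivisor s := by
  have hreg : IsRegular s := isRegular_iff_mem_nonZeroDivisors.mpr
    (mem_nonZeroDivisors_of_injective h.1 hs.mem_nonZeroDivisors)
  let f : Localization.Away s →ₐ[R] S :=
    IsLocalization.liftAlgHom (M := Submonoid.powers s) (f := Algebra.ofId R S) (by
      rintro ⟨_, n, rfl⟩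
      simpa [Algebra.ofId_apply] using hs.pow n)
  have hf : Function.Injective f := by
    rw [injective_iff_map_eq_zero]
    intro x hx
    obtain ⟨⟨a, m⟩, ha⟩ := IsLocalization.surj (Submonoid.powers s) x
    have h0 : algebraMap R S a = 0 := by
      rw [← f.commutes, ← ha, map_mul, hx, zero_mul]
    rw [(map_eq_zero_iff _ h.1).mp h0, map_zero] at ha
    exact (IsLocalization.map_units (Localization.Away s) m).mul_left_eq_zero.mp ha
  exact ⟨hreg, (h.of_injective f hf).isPruferExtension⟩

/-- If every subalgebra of finite type is a localization away from one element, then every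
subalgebra is a localization. -/
theorem isQRExtension_of_finiteType {R S : Type*} [CommRing R] [CommRing S] [Algebra R S]
    (hRS : Function.Injective (algebraMap R S))
    (h : ∀ T : Subalgebra R S, Algebra.FiniteType R T → ∃ s : R, IsLocalization.Away s T) :
    IsQRExtension R S := by
  -- Take the largest candidate: all elements of `R` invertible in `T`. A denominator of `t` over
  -- `R[t]` is a unit there, hence in `T`.
  refine ⟨hRS, fun T => ⟨(IsUnit.submonoid T).comap (algebraMap R T),
    isLocalization_of_injective (fun x y hxy => hRS (congrArg T.val hxy)) _
      (fun _ hm => hm) fun t => ?_⟩⟩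
  let U := Algebra.adjoin R {(t : S)}
  have hUT : U ≤ T := Algebra.adjoin_le (by simp)
  obtain ⟨s, hs⟩ := h U
    (U.fg_iff_finiteType.mp ⟨{(t : S)}, by simp [U]⟩)
  obtain ⟨⟨a, m⟩, ha⟩ := IsLocalization.surj (Submonoid.powers s)
    (⟨t, Algebra.subset_adjoin rfl⟩ : U)
  exact ⟨m, (IsLocalization.map_units U m).map (Subalgebra.inclusion hUT), a,
    Subtype.ext (congrArg U.val ha)⟩

theorem mainTheorem6 {R S : Type*} [CommRing R] [CommRing S] [Algebra R S]
    (hRS : Function.Injective (algebraMap R S)) :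
    (IsQRExtension R S ↔
      ∀ T : Subalgebra R S, Algebra.FiniteType R T →
        ∃ s : R, IsLocallyStrongDivisor s ∧ IsLocalization.Away s T) ∧
    (IsQRExtension R S →
      ∀ T : Subalgebra R S, ∃ M : Submonoid R,
        (∀ s ∈ M, IsLocallyStrongDivisor s) ∧ IsLocalization M T) := by
  have key (h : IsQRExtension R S) (T : Subalgebra R S) (M : Submonoid R)
      [IsLocalization M T] (s : R) (hs : s ∈ M) : IsLocallyStrongDivisor s :=
    h.isLocallyStrongDivisor ((IsLocalization.map_units T (⟨s, hs⟩ : M)).map T.val)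
  refine ⟨⟨fun h T hT => ?_, fun h => ?_⟩, fun h T => ?_⟩
  · obtain ⟨M, hM⟩ := h.2 T
    obtain ⟨s, hs, hsT⟩ := exists_isLocalization_away_of_finiteType
      (fun x y hxy => hRS (congrArg T.val hxy)) M hT
    exact ⟨s, key h T M s hs, hsT⟩
  · exact isQRExtension_of_finiteType hRS fun T hT => (h T hT).imp fun _ hs => hs.2
  · obtain ⟨M, hM⟩ := h.2 T
    exact ⟨M, key h T M, hM⟩
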